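/- Let $M$ be a compact smooth manifold of dimension $d\ge 2$ with nonempty boundary $N=\partial M$, let $E\to M$ and $F_1,\dots,F_k\to N$ be smooth complex vector bundles of finite rank, and let $A\colon C^\infty(E)\to C^\infty(E)$ be a linear differential operator of order (at most) $\omega>0$. For $1\le j\le k$ let $B_0^j,B_1^j\colon C^\infty(E)\to C^\infty(F_j)$ be boundary differential operators with $\operatorname{ord}B_0^j<\operatorname{ord}B_1^j<\omega$. For $t\in\mathbb R$ put $B_t=(B_t^1,\dots,B_t^k)$ with $B_t^j=(1-t)B_0^j+tB_1^j$, put $\omega_j(t)=\operatorname{ord}B_t^j$, and let $B'=B_1-B_0$. Let $H^s$ denote the $L^2$-based Sobolev spaces of sections. Assume that for every $0\le t\le 1$ the boundary problem $(A,B_t)$ is invertible, i.e. that its extension by continuity $$(A,B_t)\colon H^\omega(E)\to L^2(E)\oplus\bigoplus_{j=1}^k H^{\omega-\omega_j(t)-1/2}(F_j)$$ is bijective. Let $A_t$ be the operator $A$ with domain $\ker B_t\subset H^\omega(E)$, and let $\operatorname{spec}(A_t)$ be the set of $z\in\mathbb C$ for which $A_t-z\colon\ker B_t\to L^2(E)$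 is not bijective. Then for $0\le t\le1$ and $z\notin\operatorname{spec}(A_t)$ the operator $(A-z,B_t)$ between the above spaces is bijective, so that the resolvent operator $R_t(z)\colon L^2(E)\to H^\omega(E)$, $R_t(z)u=(A-z,B_t)^{-1}(u,0)$, and the Poisson operator $P_t(z)\colon\bigoplus_jH^{\omega-\omega_j(t)-1/2}(F_j)\to H^\omega(E)$, $P_t(z)f=(A-z,B_t)^{-1}(0,f)$, are well-defined bounded operators, and, with derivatives taken in the operator norm: 1. for every $0<t\le1$ and $z\notin\operatorname{spec}(A_t)$, the map $\tau\mapsto R_\tau(z)$ (given by the same formula for all real $\tau$ near $t$) is differentiable at $\tau=t$, and $$\partial_tR_t(z)=-P_t(z)\,B'\,R_t(z);$$ 2. for every $0\le t\le1$ and $z\notin\operatorname{spec}(A_t)$, the map $\zeta\mapsto P_t(\zeta)$ is complex differentiable at $\zeta=z$, and $$\partial_zP_t(z)=R_t(z)\,P_t(z),$$ where on the right $P_t(z)f\in H^\omega(E)$ is regarded as an element of $L^2(E)$. -/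

import Mathlib

/-!
Everything is read off from the derivative of the inverse, `(T⁻¹)' = -T⁻¹ T' T⁻¹`, applied to
`T = (A - z, B_t)`: it has `∂_z T = (-1, 0)` and `∂_t T = (0, B')`, and `T⁻¹` restricts to the
resolvent operator on `L²` and to the Poisson operator on the boundary data.

Two points have to be settled before `T` can be differentiated in `t`. First, the target of `T`
depends on the orders of `B_t`; since `ord B₀ < ord B₁`, these agree with the orders of `B₁` for
`t ≠ 0`. Second, `t ↦ B_t` has to be affine as a family of bounded operators. An operator whose
extension by continuity is onto is bounded, so `B_s` and `B_t` are bounded for two different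
nonzero parameters, and hence so is their multiple `B' = (B_s - B_t) / (s - t)`.
-/

open Set MeasureTheory Bundle Manifold
open scoped ContDiff Topology

noncomputable section

namespace BVP

/-! ### Smooth sections of complex vector bundles

A smooth complex vector bundle over a real manifold is a bundle `V` whose trivializations are
`ℂ`-linear on the fibres (`VectorBundle ℂ F V`) and whose transition functions are smooth over `ℝ`
(`VectorBundle ℝ F V` and `ContMDiffVectorBundle ∞ F V I`). -/

section Sections

variable {E : Type*} [NormedAddCommGroup E] [NormedSpace ℝ E]
  {H : Type*} [TopologicalSpace H] (I : ModelWithCorners ℝ E H)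
  {M : Type*} [TopologicalSpace M] [ChartedSpace H M]
  (F : Type*) [NormedAddCommGroup F] [NormedSpace ℂ F]
  (V : M → Type*) [TopologicalSpace (TotalSpace F V)] [∀ x, TopologicalSpace (V x)]
  [∀ x, AddCommGroup (V x)] [∀ x, Module ℂ (V x)]
  [FiberBundle F V] [VectorBundle ℝ F V] [VectorBundle ℂ F V]

/-- The complex vector space `C^∞(V)` of smooth sections of `V`. -/
def SmoothSections : Submodule ℂ (∀ x, V x) where
  carrier := {s | ContMDiff I (I.prod 𝓘(ℝ, F)) ∞ fun x => TotalSpace.mk' F x (s x)}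
  add_mem' hs ht := ContMDiff.add_section hs ht
  zero_mem' := contMDiff_zeroSection ℝ V
  smul_mem' c s hs := by
    intro x₀
    have h := (contMDiffAt_section x₀).1 (hs x₀)
    refine (contMDiffAt_section x₀).2 ?_
    set e := trivializationAt F V x₀
    have h2 := ((c • ContinuousLinearMap.id ℝ F).contMDiff (n := ∞)).contMDiffAt.comp x₀ h
    refine h2.congr_of_eventuallyEq ?_
    filter_upwards [e.open_baseSet.mem_nhds (mem_baseSet_trivializationAt F V x₀)] with x hx
    exact (e.linear ℂ hx).2 c (s x)

variable {I F V}

/-- Multiplication of smooth sections by a smooth real function. -/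
def mulFun (f : C^∞⟮I, M; 𝓘(ℝ, ℝ), ℝ⟯) : SmoothSections I F V →ₗ[ℂ] SmoothSections I F V where
  toFun s := ⟨fun x => f x • s.1 x, ContMDiff.smul_section f.contMDiff s.2⟩
  map_add' s t := by ext x; exact smul_add _ _ _
  map_smul' c s := by ext x; exact smul_comm _ _ _

end Sections

/-! ### Differential operators -/

section DiffOp

variable {E : Type*} [NormedAddCommGroup E] [NormedSpace ℝ E]
  {H : Type*} [TopologicalSpace H] {I : ModelWithCorners ℝ E H}
  {M : Type*} [TopologicalSpace M] [ChartedSpace H M]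
  {F : Type*} [NormedAddCommGroup F] [NormedSpace ℂ F]
  {V : M → Type*} [TopologicalSpace (TotalSpace F V)] [∀ x, TopologicalSpace (V x)]
  [∀ x, AddCommGroup (V x)] [∀ x, Module ℂ (V x)]
  [FiberBundle F V] [VectorBundle ℝ F V] [VectorBundle ℂ F V]
  {E' : Type*} [NormedAddCommGroup E'] [NormedSpace ℝ E']
  {H' : Type*} [TopologicalSpace H'] {J : ModelWithCorners ℝ E' H'}
  {N : Type*} [TopologicalSpace N] [ChartedSpace H' N]
  {G : Type*} [NormedAddCommGroup G] [NormedSpace ℂ G]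
  {W : N → Type*} [TopologicalSpace (TotalSpace G W)] [∀ x, TopologicalSpace (W x)]
  [∀ x, AddCommGroup (W x)] [∀ x, Module ℂ (W x)]
  [FiberBundle G W] [VectorBundle ℝ G W] [VectorBundle ℂ G W]

/-- The commutator `[B, f] = B ∘ f - (f ∘ ι) ∘ B` of an operator `B : C^∞(M; V) → C^∞(N; W)` with
multiplication by a smooth function `f` on `M`, which acts on sections over `N` through
`ι : N → M`. -/
def commutator (ι : C^∞⟮J, N; I, M⟯) (f : C^∞⟮I, M; 𝓘(ℝ, ℝ), ℝ⟯)
    (B : SmoothSections I F V →ₗ[ℂ] SmoothSections J G W) :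
    SmoothSections I F V →ₗ[ℂ] SmoothSections J G W :=
  B ∘ₗ mulFun f - mulFun (f.comp ι) ∘ₗ B

/-- `B : C^∞(M; V) → C^∞(N; W)` is a differential operator of order at most `m` along
`ι : N → M`, in Grothendieck's sense: all its `(m + 1)`-fold commutators with smooth functions on
`M` vanish. Equivalently, `(B u)(x)` is in local coordinates a linear combination, with smooth
coefficients, of the partial derivatives of `u` of order at most `m` at `ι x`.
For `ι = id` these are the differential operators on `M`; for the inclusion `ι` of the boundary
`N = ∂M` these are the boundary differential operators. -/
def IsDiffOp (ι : C^∞⟮J, N; I, M⟯) :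
    ℕ → (SmoothSections I F V →ₗ[ℂ] SmoothSections J G W) → Prop
  | 0, B => ∀ f, commutator ι f B = 0
  | m + 1, B => ∀ f, IsDiffOp ι m (commutator ι f B)

/-- The order of a differential operator. -/
def diffOrder (ι : C^∞⟮J, N; I, M⟯)
    (B : SmoothSections I F V →ₗ[ℂ] SmoothSections J G W) : ℕ :=
  sInf {m | IsDiffOp ι m B}

end DiffOp

/-! ### Sobolev spaces of sections over a compact manifold -/

section Sobolev

variable {E : Type*} [NormedAddCommGroup E] [InnerProductSpace ℝ E] [FiniteDimensional ℝ E]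
  [MeasurableSpace E] [BorelSpace E]
  {H : Type*} [TopologicalSpace H] (I : ModelWithCorners ℝ E H)
  {M : Type*} [TopologicalSpace M] [ChartedSpace H M]
  (F : Type*) [NormedAddCommGroup F] [NormedSpace ℂ F]
  (V : M → Type*) [TopologicalSpace (TotalSpace F V)] [∀ x, TopologicalSpace (V x)]
  [FiberBundle F V]

/-- The choices that enter the definition of a Sobolev norm on the sections of `V`: finitely many
charts of `M` over which `V` is trivialized, and a subordinate partition of unity. Two choices give
equivalent norms. -/
structure SobolevAtlas where
  /-- the number of charts -/
  card : ℕ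
  /-- the centres of the charts and of the trivializations -/
  center : Fin card → M
  /-- the partition of unity -/
  ρ : SmoothPartitionOfUnity (Fin card) I M univ
  subordinate : ρ.IsSubordinate fun i =>
    (chartAt H (center i)).source ∩ (trivializationAt F V (center i)).baseSet

theorem SobolevAtlas.nonempty [T2Space M] [CompactSpace M] [IsManifold I ∞ M] :
    Nonempty (SobolevAtlas I F V) := by
  obtain ⟨t, ht⟩ := isCompact_univ.elim_finite_subcover
    (fun c : M => (chartAt H c).source ∩ (trivializationAt F V c).baseSet)
    (fun c => (chartAt H c).open_source.inter (trivializationAt F V c).open_baseSet)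
    (fun x _ => mem_iUnion.2 ⟨x, mem_chart_source H x, mem_baseSet_trivializationAt F V x⟩)
  let c : Fin t.card → M := fun i => (t.equivFin.symm i : M)
  obtain ⟨ρ, hρ⟩ := SmoothPartitionOfUnity.exists_isSubordinate I (isClosed_univ (X := M))
    (fun i => (chartAt H (c i)).source ∩ (trivializationAt F V (c i)).baseSet)
    (fun i => (chartAt H (c i)).open_source.inter (trivializationAt F V (c i)).open_baseSet)
    (fun x hx => by
      obtain ⟨p, hp, hxp⟩ := mem_iUnion₂.1 (ht hx)
      exact mem_iUnion.2 ⟨t.equivFin ⟨p, hp⟩, by simpa [c] using hxp⟩)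
  exact ⟨⟨_, c, ρ, hρ⟩⟩

variable {I F V}

/-- The `i`-th piece `ρ_i s` of a section `s`, read in the `i`-th chart and trivialization, and
extended by `0`. -/
def localRep (𝔞 : SobolevAtlas I F V) (i : Fin 𝔞.card) (s : ∀ x, V x) : E → F :=
  (extChartAt I (𝔞.center i)).target.indicator fun y =>
    𝔞.ρ i ((extChartAt I (𝔞.center i)).symm y) •
      (trivializationAt F V (𝔞.center i)
        (TotalSpace.mk' F ((extChartAt I (𝔞.center i)).symm y)
          (s ((extChartAt I (𝔞.center i)).symm y)))).2

variable [∀ x, AddCommGroup (V x)] [∀ x, Module ℂ (V x)] [VectorBundle ℝ F V] [VectorBundle ℂ F V]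

theorem localRep_add (𝔞 : SobolevAtlas I F V) (i : Fin 𝔞.card) (s t : ∀ x, V x) :
    localRep 𝔞 i (s + t) = localRep 𝔞 i s + localRep 𝔞 i t := by
  funext y
  by_cases hy : y ∈ (extChartAt I (𝔞.center i)).target
  · simp only [localRep, Pi.add_apply, indicator_of_mem hy]
    by_cases h0 : 𝔞.ρ i ((extChartAt I (𝔞.center i)).symm y) = 0
    · simp only [h0, zero_smul, add_zero, smul_zero]
    · have hb := (𝔞.subordinate i (subset_tsupport _ h0)).2
      rw [← smul_add]
      congr 1
      exact ((trivializationAt F V (𝔞.center i)).linear ℂ hb).1 _ _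
  · simp only [localRep, Pi.add_apply, Pi.smul_apply, indicator_of_notMem hy, add_zero, smul_zero]

theorem localRep_smul (𝔞 : SobolevAtlas I F V) (i : Fin 𝔞.card) (c : ℂ) (s : ∀ x, V x) :
    localRep 𝔞 i (c • s) = c • localRep 𝔞 i s := by
  funext y
  by_cases hy : y ∈ (extChartAt I (𝔞.center i)).target
  · simp only [localRep, Pi.smul_apply, indicator_of_mem hy]
    by_cases h0 : 𝔞.ρ i ((extChartAt I (𝔞.center i)).symm y) = 0
    · simp only [h0, zero_smul, add_zero, smul_zero]
    · have hb := (𝔞.subordinate i (subset_tsupport _ h0)).2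
      rw [smul_comm c]
      congr 1
      exact ((trivializationAt F V (𝔞.center i)).linear ℂ hb).2 _ _
  · simp only [localRep, Pi.add_apply, Pi.smul_apply, indicator_of_notMem hy, add_zero, smul_zero]

/-- The compact subset of the `i`-th chart that carries all the pieces `localRep 𝔞 i s`. -/
def pieceSupport (𝔞 : SobolevAtlas I F V) (i : Fin 𝔞.card) : Set E :=
  extChartAt I (𝔞.center i) '' tsupport (𝔞.ρ i)

theorem isCompact_pieceSupport [CompactSpace M] (𝔞 : SobolevAtlas I F V) (i : Fin 𝔞.card) :
    IsCompact (pieceSupport 𝔞 i) := by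
  refine (isClosed_tsupport _).isCompact.image_of_continuousOn ?_
  refine (continuousOn_extChartAt (𝔞.center i)).mono fun x hx => ?_
  rw [extChartAt_source]
  exact (𝔞.subordinate i hx).1

theorem localRep_eq_zero (𝔞 : SobolevAtlas I F V) (i : Fin 𝔞.card) (s : ∀ x, V x) {y : E}
    (hy : y ∉ pieceSupport 𝔞 i) : localRep 𝔞 i s y = 0 := by
  by_cases ht : y ∈ (extChartAt I (𝔞.center i)).target
  · have h0 : 𝔞.ρ i ((extChartAt I (𝔞.center i)).symm y) = 0 := by
      by_contra h0
      exact hy ⟨_, subset_tsupport _ h0, (extChartAt I (𝔞.center i)).right_inv ht⟩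
    simp only [localRep, indicator_of_mem ht, h0, zero_smul]
  · simp only [localRep, indicator_of_notMem ht]

theorem hasCompactSupport_localRep [CompactSpace M] (𝔞 : SobolevAtlas I F V) (i : Fin 𝔞.card)
    (s : ∀ x, V x) : HasCompactSupport (localRep 𝔞 i s) :=
  HasCompactSupport.intro (isCompact_pieceSupport 𝔞 i) fun _ hy => localRep_eq_zero 𝔞 i s hy

variable [CompactSpace M] [IsManifold I ∞ M] [ContMDiffVectorBundle ∞ F V I]

theorem contDiffOn_localRep (𝔞 : SobolevAtlas I F V) (i : Fin 𝔞.card) (s : SmoothSections I F V) :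
    ContDiffOn ℝ ∞ (localRep 𝔞 i s.1) (range I) := by
  set φ := extChartAt I (𝔞.center i) with hφ
  set e := trivializationAt F V (𝔞.center i) with he
  have hg : ContMDiff I 𝓘(ℝ, F) ∞ fun x => 𝔞.ρ i x • (e (TotalSpace.mk' F x (s.1 x))).2 :=
    𝔞.ρ.contMDiff_smul (n := ⊤) fun x hx =>
      (e.contMDiffAt_section_iff (𝔞.subordinate i hx).2).1 (s.2 x)
  have h1 : ContDiffOn ℝ ∞ (localRep 𝔞 i s.1) φ.target := by
    have h2 := (hg.comp_contMDiffOn (contMDiffOn_extChartAt_symm (n := ∞) (𝔞.center i)))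
    refine (contMDiffOn_iff_contDiffOn.1 h2).congr fun y hy => ?_
    exact indicator_of_mem hy _
  intro y hy
  by_cases ht : y ∈ φ.target
  · exact (h1 y ht).mono_of_mem_nhdsWithin (extChartAt_target_mem_nhdsWithin_of_mem ht)
  · have hK : y ∉ pieceSupport 𝔞 i := by
      rintro ⟨x, hx, rfl⟩
      refine ht (φ.map_source ?_)
      rw [hφ, extChartAt_source]
      exact (𝔞.subordinate i hx).1
    have hev : localRep 𝔞 i s.1 =ᶠ[𝓝 y] fun _ => 0 := by
      filter_upwards [(isCompact_pieceSupport 𝔞 i).isClosed.isOpen_compl.mem_nhds hK] with z hz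
      exact localRep_eq_zero 𝔞 i s.1 hz
    exact (contDiffAt_const.congr_of_eventuallyEq hev).contDiffWithinAt

/-- The `k`-th derivative of the `i`-th piece of a smooth section. The model space is
`range I`, a half-space if `M` has a boundary. -/
def pieceDeriv (𝔞 : SobolevAtlas I F V) (i : Fin 𝔞.card) (k : ℕ) (s : SmoothSections I F V) :
    E → E [×k]→L[ℝ] F :=
  iteratedFDerivWithin ℝ k (localRep 𝔞 i s.1) (range I)

theorem memLp_pieceDeriv (𝔞 : SobolevAtlas I F V) (i : Fin 𝔞.card) (k : ℕ)
    (s : SmoothSections I F V) :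
    MemLp (pieceDeriv 𝔞 i k s) 2 (volume.restrict (range I)) := by
  have hK := isCompact_pieceSupport 𝔞 i
  have hc : ContinuousOn (pieceDeriv 𝔞 i k s) (range I) :=
    (contDiffOn_localRep 𝔞 i s).continuousOn_iteratedFDerivWithin
      (mod_cast le_top) I.uniqueDiffOn
  have h0 : ∀ y ∈ range I, y ∉ pieceSupport 𝔞 i → pieceDeriv 𝔞 i k s y = 0 := by
    intro y hy hyK
    have hev : localRep 𝔞 i s.1 =ᶠ[𝓝[range I] y] fun _ => 0 := by
      filter_upwards [mem_nhdsWithin_of_mem_nhds (hK.isClosed.isOpen_compl.mem_nhds hyK)] with z hz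
      exact localRep_eq_zero 𝔞 i s.1 hz
    have := hev.iteratedFDerivWithin_eq (𝕜 := ℝ) (localRep_eq_zero 𝔞 i s.1 hyK) k
    simpa [pieceDeriv] using this
  obtain ⟨C, hC⟩ := (hK.inter_right I.isClosed_range).exists_bound_of_continuousOn
    (hc.mono inter_subset_right)
  have hm : AEStronglyMeasurable (pieceDeriv 𝔞 i k s) (volume.restrict (range I)) :=
    hc.aestronglyMeasurable I.isClosed_range.measurableSet
  have hind : MemLp ((pieceSupport 𝔞 i).indicator (pieceDeriv 𝔞 i k s)) 2
      (volume.restrict (range I)) := by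
    refine (memLp_indicator_iff_restrict (f := pieceDeriv 𝔞 i k s) hK.isClosed.measurableSet).2 ?_
    have : IsFiniteMeasure ((volume.restrict (range I)).restrict (pieceSupport 𝔞 i)) :=
      ⟨by
        rw [Measure.restrict_apply_univ]
        exact (Measure.restrict_apply_le _ _).trans_lt hK.measure_lt_top⟩
    refine MemLp.of_bound (hm.mono_measure Measure.restrict_le_self) C ?_
    rw [Measure.restrict_restrict hK.isClosed.measurableSet]
    filter_upwards [ae_restrict_mem (hK.isClosed.measurableSet.inter
      I.isClosed_range.measurableSet)] with y hy
    exact hC y hy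
  refine hind.ae_eq ?_
  filter_upwards [ae_restrict_mem I.isClosed_range.measurableSet] with y hy
  by_cases hyK : y ∈ pieceSupport 𝔞 i
  · simp [hyK]
  · simp [hyK, h0 y hy hyK]

/-- The derivatives up to order `m` of all the pieces of a smooth section, as `L²` functions. -/
def sobolevJet (𝔞 : SobolevAtlas I F V) (m : ℕ) : SmoothSections I F V →ₗ[ℂ]
    ∀ p : Fin 𝔞.card × Fin (m + 1),
      Lp (E [×(p.2 : ℕ)]→L[ℝ] F) 2 (volume.restrict (range I)) where
  toFun s p := (memLp_pieceDeriv 𝔞 p.1 p.2 s).toLp _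
  map_add' s t := by
    funext p
    rw [Pi.add_apply, ← MemLp.toLp_add]
    refine MemLp.toLp_congr _ _ ?_
    filter_upwards [ae_restrict_mem I.isClosed_range.measurableSet] with y hy
    have := iteratedFDerivWithin_add_apply (i := (p.2 : ℕ)) (x := y)
      (((contDiffOn_localRep 𝔞 p.1 s) y hy).of_le (mod_cast le_top))
      (((contDiffOn_localRep 𝔞 p.1 t) y hy).of_le (mod_cast le_top)) I.uniqueDiffOn hy
    simpa [pieceDeriv, localRep_add] using this
  map_smul' c s := by
    funext p
    rw [Pi.smul_apply, RingHom.id_apply, ← MemLp.toLp_const_smul]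
    refine MemLp.toLp_congr _ _ ?_
    filter_upwards [ae_restrict_mem I.isClosed_range.measurableSet] with y hy
    have := iteratedFDerivWithin_const_smul_apply (i := (p.2 : ℕ)) (x := y) (a := c)
      (((contDiffOn_localRep 𝔞 p.1 s) y hy).of_le (mod_cast le_top)) I.uniqueDiffOn hy
    simpa [pieceDeriv, localRep_smul] using this

/-- The Sobolev space `H^m(V)`, `m ∈ ℕ`: the completion of `C^∞(V)` in the norm
`max_{i, k ≤ m} ‖D^k (ρ_i s)‖_{L²}`, realized as the closure of the space of jets of smooth
sections. For `m = 0` it is `L²(V)`. -/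
def SobolevSpace (𝔞 : SobolevAtlas I F V) (m : ℕ) : Type _ :=
  (LinearMap.range (sobolevJet 𝔞 m)).topologicalClosure

instance (𝔞 : SobolevAtlas I F V) (m : ℕ) : NormedAddCommGroup (SobolevSpace 𝔞 m) :=
  inferInstanceAs (NormedAddCommGroup (LinearMap.range (sobolevJet 𝔞 m)).topologicalClosure)

instance (𝔞 : SobolevAtlas I F V) (m : ℕ) : NormedSpace ℂ (SobolevSpace 𝔞 m) :=
  inferInstanceAs (NormedSpace ℂ (LinearMap.range (sobolevJet 𝔞 m)).topologicalClosure)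

instance [FiniteDimensional ℂ F] (𝔞 : SobolevAtlas I F V) (m : ℕ) : CompleteSpace (SobolevSpace 𝔞 m) := by
  have : CompleteSpace F := FiniteDimensional.complete ℂ F
  exact inferInstanceAs (CompleteSpace (LinearMap.range (sobolevJet 𝔞 m)).topologicalClosure)

/-- A smooth section as an element of `H^m(V)`. -/
def toSobolev (𝔞 : SobolevAtlas I F V) (m : ℕ) : SmoothSections I F V →ₗ[ℂ] SobolevSpace 𝔞 m :=
  (sobolevJet 𝔞 m).codRestrict _ fun s =>
    Submodule.le_topologicalClosure _ (LinearMap.mem_range_self _ s)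

variable [I.Boundaryless]

/-- On a manifold without boundary, the `i`-th piece of a smooth section as a Schwartz function. -/
def pieceSchwartz (𝔞 : SobolevAtlas I F V) (i : Fin 𝔞.card) :
    SmoothSections I F V →ₗ[ℂ] SchwartzMap E F where
  toFun s := (hasCompactSupport_localRep 𝔞 i s.1).toSchwartzMap
    (contDiffOn_univ.1 (I.range_eq_univ ▸ contDiffOn_localRep 𝔞 i s))
  map_add' s t := by ext y; exact congrFun (localRep_add 𝔞 i s.1 t.1) y
  map_smul' c s := by ext y; exact congrFun (localRep_smul 𝔞 i c s.1) y

/-- The Bessel potentials `𝓕⁻¹ (1 + |ξ|²)^{σ/2} 𝓕 (ρ_i s)` of all the pieces of a smooth section, as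
`L²` functions. -/
def besselJet (𝔞 : SobolevAtlas I F V) (σ : ℝ) : SmoothSections I F V →ₗ[ℂ]
    (Fin 𝔞.card → Lp F 2 (volume : Measure E)) :=
  LinearMap.pi fun i => (SchwartzMap.toLpCLM ℂ F 2 (volume : Measure E)).toLinearMap ∘ₗ
    (SchwartzMap.fourierMultiplierCLM F
      (fun ξ : E => (((1 + ‖ξ‖ ^ 2) ^ (σ / 2) : ℝ) : ℂ))).toLinearMap ∘ₗ pieceSchwartz 𝔞 i

/-- The Sobolev space `H^σ(V)`, `σ ∈ ℝ`, on a manifold without boundary: the completion of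
`C^∞(V)` in the norm `max_i ‖ρ_i s‖_{H^σ}`, with the Bessel potential norm of order `σ` on the
model space. -/
def FracSobolevSpace (𝔞 : SobolevAtlas I F V) (σ : ℝ) : Type _ :=
  (LinearMap.range (besselJet 𝔞 σ)).topologicalClosure

instance (𝔞 : SobolevAtlas I F V) (σ : ℝ) : NormedAddCommGroup (FracSobolevSpace 𝔞 σ) :=
  inferInstanceAs (NormedAddCommGroup (LinearMap.range (besselJet 𝔞 σ)).topologicalClosure)

instance (𝔞 : SobolevAtlas I F V) (σ : ℝ) : NormedSpace ℂ (FracSobolevSpace 𝔞 σ) :=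
  inferInstanceAs (NormedSpace ℂ (LinearMap.range (besselJet 𝔞 σ)).topologicalClosure)

instance [FiniteDimensional ℂ F] (𝔞 : SobolevAtlas I F V) (σ : ℝ) : CompleteSpace (FracSobolevSpace 𝔞 σ) := by
  have : CompleteSpace F := FiniteDimensional.complete ℂ F
  exact inferInstanceAs (CompleteSpace (LinearMap.range (besselJet 𝔞 σ)).topologicalClosure)

/-- A smooth section as an element of `H^σ(V)`. -/
def toFracSobolev (𝔞 : SobolevAtlas I F V) (σ : ℝ) :
    SmoothSections I F V →ₗ[ℂ] FracSobolevSpace 𝔞 σ :=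
  (besselJet 𝔞 σ).codRestrict _ fun s =>
    Submodule.le_topologicalClosure _ (LinearMap.mem_range_self _ s)

end Sobolev

/-! ### Boundary problems -/

section Problem

variable {E : Type*} [NormedAddCommGroup E] [InnerProductSpace ℝ E] [FiniteDimensional ℝ E]
  [MeasurableSpace E] [BorelSpace E]
  {H : Type*} [TopologicalSpace H] {I : ModelWithCorners ℝ E H}
  {M : Type*} [TopologicalSpace M] [ChartedSpace H M] [CompactSpace M] [IsManifold I ∞ M]
  {F : Type*} [NormedAddCommGroup F] [NormedSpace ℂ F] [FiniteDimensional ℂ F]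
  {V : M → Type*} [TopologicalSpace (TotalSpace F V)] [∀ x, TopologicalSpace (V x)]
  [∀ x, AddCommGroup (V x)] [∀ x, Module ℂ (V x)]
  [FiberBundle F V] [VectorBundle ℝ F V] [VectorBundle ℂ F V] [ContMDiffVectorBundle ∞ F V I]
  {E' : Type*} [NormedAddCommGroup E'] [InnerProductSpace ℝ E'] [FiniteDimensional ℝ E']
  [MeasurableSpace E'] [BorelSpace E']
  {H' : Type*} [TopologicalSpace H'] {J : ModelWithCorners ℝ E' H'} [J.Boundaryless]
  {N : Type*} [TopologicalSpace N] [ChartedSpace H' N] [CompactSpace N] [IsManifold J ∞ N]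
  {k : ℕ} {G : Fin k → Type*} [∀ j, NormedAddCommGroup (G j)] [∀ j, NormedSpace ℂ (G j)]
  [∀ j, FiniteDimensional ℂ (G j)]
  {W : ∀ _ : Fin k, N → Type*} [∀ j, TopologicalSpace (TotalSpace (G j) (W j))]
  [∀ j x, TopologicalSpace (W j x)] [∀ j x, AddCommGroup (W j x)] [∀ j x, Module ℂ (W j x)]
  [∀ j, FiberBundle (G j) (W j)] [∀ j, VectorBundle ℝ (G j) (W j)]
  [∀ j, VectorBundle ℂ (G j) (W j)] [∀ j, ContMDiffVectorBundle ∞ (G j) (W j) J]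

/-- The extension by continuity `H^r(V) → L²(V)` of an operator on `C^∞(V)`. Differential operators
of order at most `r` are bounded for these norms; `extendOfNorm` is `0` on unbounded operators. -/
def interiorExt (𝔞 : SobolevAtlas I F V) (r : ℕ)
    (A : SmoothSections I F V →ₗ[ℂ] SmoothSections I F V) :
    SobolevSpace 𝔞 r →L[ℂ] SobolevSpace 𝔞 0 :=
  (toSobolev 𝔞 0 ∘ₗ A).extendOfNorm (toSobolev 𝔞 r)

/-- The inclusion `H^r(V) → L²(V)`. -/
def inclL2 (𝔞 : SobolevAtlas I F V) (r : ℕ) : SobolevSpace 𝔞 r →L[ℂ] SobolevSpace 𝔞 0 :=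
  interiorExt 𝔞 r LinearMap.id

/-- The space `⨁_j H^{r - m_j - 1/2}(W_j)` of boundary data. -/
abbrev BoundaryData (𝔟 : ∀ j, SobolevAtlas J (G j) (W j)) (r : ℕ) (m : Fin k → ℕ) : Type _ :=
  ∀ j, FracSobolevSpace (𝔟 j) ((r : ℝ) - m j - 1 / 2)

/-- The extension by continuity `H^r(V) → ⨁_j H^{r - m_j - 1/2}(W_j)` of a tuple of operators
`B_j : C^∞(V) → C^∞(W_j)`. -/
def boundaryExt (𝔞 : SobolevAtlas I F V) (𝔟 : ∀ j, SobolevAtlas J (G j) (W j)) (r : ℕ)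
    (m : Fin k → ℕ) (B : ∀ j, SmoothSections I F V →ₗ[ℂ] SmoothSections J (G j) (W j)) :
    SobolevSpace 𝔞 r →L[ℂ] BoundaryData 𝔟 r m :=
  ContinuousLinearMap.pi fun j =>
    (toFracSobolev (𝔟 j) ((r : ℝ) - m j - 1 / 2) ∘ₗ B j).extendOfNorm (toSobolev 𝔞 r)

/-- The orders `m_j = ord B_j` of a tuple of boundary operators. -/
def orders (ι : C^∞⟮J, N; I, M⟯)
    (B : ∀ j, SmoothSections I F V →ₗ[ℂ] SmoothSections J (G j) (W j)) : Fin k → ℕ :=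
  fun j => diffOrder ι (B j)

/-- The operator
`(A - z, B) : H^r(V) → L²(V) ⊕ ⨁_j H^{r - ord B_j - 1/2}(W_j)` of a boundary problem. -/
def problem (𝔞 : SobolevAtlas I F V) (𝔟 : ∀ j, SobolevAtlas J (G j) (W j))
    (ι : C^∞⟮J, N; I, M⟯) (r : ℕ) (A : SmoothSections I F V →ₗ[ℂ] SmoothSections I F V)
    (B : ∀ j, SmoothSections I F V →ₗ[ℂ] SmoothSections J (G j) (W j)) (z : ℂ) :
    SobolevSpace 𝔞 r →L[ℂ] SobolevSpace 𝔞 0 × BoundaryData 𝔟 r (orders ι B) :=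
  (interiorExt 𝔞 r A - z • inclL2 𝔞 r).prod (boundaryExt 𝔞 𝔟 r (orders ι B) B)

/-- The resolvent operator `R(z) : L²(V) → H^r(V)`, `u ↦ (A - z, B)⁻¹ (u, 0)`. -/
def resolventOp (𝔞 : SobolevAtlas I F V) (𝔟 : ∀ j, SobolevAtlas J (G j) (W j))
    (ι : C^∞⟮J, N; I, M⟯) (r : ℕ) (A : SmoothSections I F V →ₗ[ℂ] SmoothSections I F V)
    (B : ∀ j, SmoothSections I F V →ₗ[ℂ] SmoothSections J (G j) (W j)) (z : ℂ) :
    SobolevSpace 𝔞 0 →L[ℂ] SobolevSpace 𝔞 r :=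
  (problem 𝔞 𝔟 ι r A B z).inverse ∘L
    ContinuousLinearMap.inl ℂ (SobolevSpace 𝔞 0) (BoundaryData 𝔟 r (orders ι B))

/-- The Poisson operator `P(z) : ⨁_j H^{r - ord B_j - 1/2}(W_j) → H^r(V)`,
`f ↦ (A - z, B)⁻¹ (0, f)`. -/
def poissonOp (𝔞 : SobolevAtlas I F V) (𝔟 : ∀ j, SobolevAtlas J (G j) (W j))
    (ι : C^∞⟮J, N; I, M⟯) (r : ℕ) (A : SmoothSections I F V →ₗ[ℂ] SmoothSections I F V)
    (B : ∀ j, SmoothSections I F V →ₗ[ℂ] SmoothSections J (G j) (W j)) (z : ℂ) :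
    BoundaryData 𝔟 r (orders ι B) →L[ℂ] SobolevSpace 𝔞 r :=
  (problem 𝔞 𝔟 ι r A B z).inverse ∘L
    ContinuousLinearMap.inr ℂ (SobolevSpace 𝔞 0) (BoundaryData 𝔟 r (orders ι B))

/-- The spectrum of the realization `A_B` of `A` with domain `ker B ⊆ H^r(V)`: the set of all `z`
for which `A_B - z : ker B → L²(V)` is not bijective. (A bounded bijection between the Banach spaces
`ker B` and `L²(V)` has a bounded inverse.) -/
def realizationSpectrum (𝔞 : SobolevAtlas I F V) (𝔟 : ∀ j, SobolevAtlas J (G j) (W j))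
    (ι : C^∞⟮J, N; I, M⟯) (r : ℕ) (A : SmoothSections I F V →ₗ[ℂ] SmoothSections I F V)
    (B : ∀ j, SmoothSections I F V →ₗ[ℂ] SmoothSections J (G j) (W j)) : Set ℂ :=
  {z | ¬ Function.Bijective
    fun u : LinearMap.ker (boundaryExt 𝔞 𝔟 r (orders ι B) B).toLinearMap =>
      interiorExt 𝔞 r A u - z • inclL2 𝔞 r u}

/-- The interpolating boundary operators `B_t = (1 - t) B_0 + t B_1`. -/
def interp (B₀ B₁ : ∀ j, SmoothSections I F V →ₗ[ℂ] SmoothSections J (G j) (W j)) (t : ℝ) :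
    ∀ j, SmoothSections I F V →ₗ[ℂ] SmoothSections J (G j) (W j) :=
  fun j => ((1 - t : ℝ) : ℂ) • B₀ j + (t : ℂ) • B₁ j

end Problem

end BVP

namespace BVP

/-! ### Inverses of bounded operators -/

section Inverse

variable {𝕜 X Y Z : Type*} [NontriviallyNormedField 𝕜]
  [NormedAddCommGroup X] [NormedSpace 𝕜 X] [NormedAddCommGroup Y] [NormedSpace 𝕜 Y]
  [NormedAddCommGroup Z] [NormedSpace 𝕜 Z]

theorem hasDerivAt_prod {L : 𝕜 → X →L[𝕜] Y} {L' : X →L[𝕜] Y} {B : 𝕜 → X →L[𝕜] Z}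
    {B' : X →L[𝕜] Z} {x : 𝕜} (hL : HasDerivAt L L' x) (hB : HasDerivAt B B' x) :
    HasDerivAt (fun y => (L y).prod (B y)) (L'.prod B') x :=
  (ContinuousLinearMap.prodₗᵢ (𝕜 := 𝕜) (E := X) (F := Y) (G := Z)
    𝕜).toContinuousLinearEquiv.hasFDerivAt.comp_hasDerivAt x (hL.prodMk hB)

theorem hasDerivAt_ringInverse_of_eq_one {R : Type*} [NormedRing R] [HasSummableGeomSeries R]
    [NormedAlgebra 𝕜 R] {c : 𝕜 → R} {c' : R} {x : 𝕜} (hc : HasDerivAt c c' x) (hx : c x = 1) :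
    HasDerivAt (fun y => Ring.inverse (c y)) (-c') x := by
  have h := hasFDerivAt_ringInverse (𝕜 := 𝕜) (1 : Rˣ)
  rw [Units.val_one, ← hx] at h
  refine (h.comp_hasDerivAt x hc).congr_deriv ?_
  rw [neg_apply, ContinuousLinearMap.mulLeftRight_apply, inv_one, Units.val_one, one_mul, mul_one]

variable [CompleteSpace X]

theorem isInvertible_of_bijective [CompleteSpace Y] {T : X →L[𝕜] Y} (hT : Function.Bijective T) :
    T.IsInvertible :=
  ⟨.ofBijective T (LinearMap.ker_eq_bot.2 hT.1) (LinearMap.range_eq_top.2 hT.2),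
    ContinuousLinearEquiv.coe_ofBijective ..⟩

theorem hasDerivAt_inverse {T : 𝕜 → X →L[𝕜] Y} {T' : X →L[𝕜] Y} {x : 𝕜}
    (hT : HasDerivAt T T' x) (hx : (T x).IsInvertible) :
    HasDerivAt (fun y => (T y).inverse) (-((T x).inverse ∘L T' ∘L (T x).inverse)) x := by
  obtain ⟨e, he⟩ := hx
  have heT : HasDerivAt (fun y => (e.symm : Y →L[𝕜] X) ∘L T y) ((e.symm : Y →L[𝕜] X) ∘L T') x := by
    simpa using (hasDerivAt_const x (e.symm : Y →L[𝕜] X)).clm_comp hT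
  have hone : (e.symm : Y →L[𝕜] X) ∘L T x = 1 := by
    rw [← he]
    exact e.coe_symm_comp_coe
  have hinv := (hasDerivAt_ringInverse_of_eq_one heT hone).clm_comp
    (hasDerivAt_const x (e.symm : Y →L[𝕜] X))
  refine (hinv.congr_of_eventuallyEq <| .of_forall fun y =>
    ContinuousLinearMap.inverse_eq_ringInverse e (T y)).congr_deriv ?_
  rw [← he]
  ext v
  simp

theorem hasDerivAt_inverse_prod_comp_inl [CompleteSpace Y] [CompleteSpace Z] {L : X →L[𝕜] Y}
    {B : 𝕜 → X →L[𝕜] Z} {B' : X →L[𝕜] Z} {x : 𝕜} (hB : HasDerivAt B B' x)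
    (hx : Function.Bijective (L.prod (B x))) :
    HasDerivAt (fun y => (L.prod (B y)).inverse ∘L .inl 𝕜 Y Z)
      (-(((L.prod (B x)).inverse ∘L .inr 𝕜 Y Z) ∘L B' ∘L
        (L.prod (B x)).inverse ∘L .inl 𝕜 Y Z)) x := by
  have hT : HasDerivAt (fun y => L.prod (B y)) (.prod 0 B') x :=
    hasDerivAt_prod (hasDerivAt_const x L) hB
  refine ((hasDerivAt_inverse hT (isInvertible_of_bijective hx)).clm_comp
    (hasDerivAt_const x (.inl 𝕜 Y Z))).congr_deriv ?_
  ext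
  simp

theorem hasDerivAt_inverse_prod_comp_inr [CompleteSpace Y] [CompleteSpace Z] {L : 𝕜 → X →L[𝕜] Y}
    {L' : X →L[𝕜] Y} {B : X →L[𝕜] Z} {x : 𝕜} (hL : HasDerivAt L L' x)
    (hx : Function.Bijective ((L x).prod B)) :
    HasDerivAt (fun y => ((L y).prod B).inverse ∘L .inr 𝕜 Y Z)
      (-((((L x).prod B).inverse ∘L .inl 𝕜 Y Z) ∘L L' ∘L
        ((L x).prod B).inverse ∘L .inr 𝕜 Y Z)) x := by
  have hT : HasDerivAt (fun y => (L y).prod B) (.prod L' 0) x :=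
    hasDerivAt_prod hL (hasDerivAt_const x B)
  refine ((hasDerivAt_inverse hT (isInvertible_of_bijective hx)).clm_comp
    (hasDerivAt_const x (.inr 𝕜 Y Z))).congr_deriv ?_
  ext
  simp

end Inverse

theorem bijective_prod_of_bijective_domRestrict_ker {R X Y Z : Type*} [Ring R] [AddCommGroup X]
    [Module R X] [AddCommGroup Y] [Module R Y] [AddCommGroup Z] [Module R Z] {L : X →ₗ[R] Y}
    {B : X →ₗ[R] Z} (hB : Function.Surjective B)
    (hL : Function.Bijective (L.domRestrict (LinearMap.ker B))) :
    Function.Bijective (L.prod B) := by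
  constructor
  · refine (injective_iff_map_eq_zero _).2 fun u hu => ?_
    obtain ⟨hLu, hBu⟩ := Prod.ext_iff.1 hu
    exact congrArg Subtype.val
      ((injective_iff_map_eq_zero _).1 hL.1 ⟨u, hBu⟩ hLu)
  · rintro ⟨y, w⟩
    obtain ⟨v, rfl⟩ := hB w
    obtain ⟨u, hu⟩ := hL.2 (y - L v)
    exact ⟨u + v, by simpa using eq_sub_iff_add_eq.1 hu⟩

/-! ### Extension by continuity -/

section ExtendOfNorm

theorem denseRange_codRestrict_topologicalClosure {R X Y : Type*} [Semiring R]
    [AddCommMonoid X] [Module R X] [AddCommMonoid Y] [Module R Y] [TopologicalSpace Y]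
    [ContinuousAdd Y] [ContinuousConstSMul R Y] (f : X →ₗ[R] Y) :
    DenseRange (f.codRestrict (LinearMap.range f).topologicalClosure fun x =>
      Submodule.le_topologicalClosure _ (LinearMap.mem_range_self _ x)) := by
  intro y
  rw [Topology.IsInducing.subtypeVal.closure_eq_preimage_closure_image, mem_preimage, ← range_comp]
  exact y.2

variable {𝕜 S X Y : Type*} [NontriviallyNormedField 𝕜] [AddCommGroup S] [Module 𝕜 S]
  [NormedAddCommGroup X] [NormedSpace 𝕜 X] [NormedAddCommGroup Y] [NormedSpace 𝕜 Y]

/-- The linear maps `f : S → Y` that are bounded with respect to the seminorm `‖e ·‖` on `S`. These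
are the maps for which `f.extendOfNorm e` is an extension of `f`, and not the junk value `0`. -/
def boundedAlong (e : S →ₗ[𝕜] X) (Y : Type*) [NormedAddCommGroup Y] [NormedSpace 𝕜 Y] :
    Submodule 𝕜 (S →ₗ[𝕜] Y) where
  carrier := {f | ∃ C : ℝ, ∀ x, ‖f x‖ ≤ C * ‖e x‖}
  add_mem' := by
    rintro f g ⟨C, hC⟩ ⟨D, hD⟩
    exact ⟨C + D, fun x => (norm_add_le_of_le (hC x) (hD x)).trans_eq (add_mul ..).symm⟩
  zero_mem' := ⟨0, by simp⟩
  smul_mem' := by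
    rintro c f ⟨C, hC⟩
    refine ⟨‖c‖ * C, fun x => ?_⟩
    rw [LinearMap.smul_apply, norm_smul, mul_assoc]
    gcongr
    exact hC x

variable [CompleteSpace Y] {e : S →ₗ[𝕜] X} {f g : S →ₗ[𝕜] Y}

theorem extendOfNorm_eq_zero_of_notMem_boundedAlong (hf : f ∉ boundedAlong e Y) :
    f.extendOfNorm e = 0 := by
  have hcomp : f.compLeftInverse e = 0 := dif_neg hf
  rw [LinearMap.extendOfNorm, hcomp]
  by_cases h : DenseRange (LinearMap.range e).subtypeL ∧
      IsUniformInducing (LinearMap.range e).subtypeL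
  · exact ContinuousLinearMap.extend_zero h.1 h.2
  · exact dif_neg h

/-- For an unbounded `f` the extension is `0`, which is onto only if `Y = 0`, and then every `f` is
bounded. -/
theorem mem_boundedAlong_of_surjective_extendOfNorm
    (hf : Function.Surjective (f.extendOfNorm e)) : f ∈ boundedAlong e Y := by
  by_contra hnot
  rw [extendOfNorm_eq_zero_of_notMem_boundedAlong hnot] at hf
  refine hnot ⟨0, fun x => ?_⟩
  obtain ⟨u, hu⟩ := hf (f x)
  simp [← hu]

theorem extendOfNorm_add_smul (he : DenseRange e) (c : 𝕜) (hf : f ∈ boundedAlong e Y)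
    (hg : g ∈ boundedAlong e Y) :
    (f + c • g).extendOfNorm e = f.extendOfNorm e + c • g.extendOfNorm e := by
  obtain ⟨C, hC⟩ := add_mem hf (Submodule.smul_mem _ c hg)
  refine LinearMap.extendOfNorm_unique he C hC _ ?_
  ext x
  simp [LinearMap.extendOfNorm_eq he hf, LinearMap.extendOfNorm_eq he hg]

end ExtendOfNorm

/-! ### The order of a differential operator -/

section DiffOp

variable {E : Type*} [NormedAddCommGroup E] [NormedSpace ℝ E]
  {H : Type*} [TopologicalSpace H] {I : ModelWithCorners ℝ E H}
  {M : Type*} [TopologicalSpace M] [ChartedSpace H M]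
  {F : Type*} [NormedAddCommGroup F] [NormedSpace ℂ F]
  {V : M → Type*} [TopologicalSpace (TotalSpace F V)] [∀ x, TopologicalSpace (V x)]
  [∀ x, AddCommGroup (V x)] [∀ x, Module ℂ (V x)]
  [FiberBundle F V] [VectorBundle ℝ F V] [VectorBundle ℂ F V]
  {E' : Type*} [NormedAddCommGroup E'] [NormedSpace ℝ E']
  {H' : Type*} [TopologicalSpace H'] {J : ModelWithCorners ℝ E' H'}
  {N : Type*} [TopologicalSpace N] [ChartedSpace H' N]
  {G : Type*} [NormedAddCommGroup G] [NormedSpace ℂ G]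
  {W : N → Type*} [TopologicalSpace (TotalSpace G W)] [∀ x, TopologicalSpace (W x)]
  [∀ x, AddCommGroup (W x)] [∀ x, Module ℂ (W x)]
  [FiberBundle G W] [VectorBundle ℝ G W] [VectorBundle ℂ G W]
  {ι : C^∞⟮J, N; I, M⟯} {B C : SmoothSections I F V →ₗ[ℂ] SmoothSections J G W}

theorem commutator_add (f : C^∞⟮I, M; 𝓘(ℝ, ℝ), ℝ⟯)
    (B C : SmoothSections I F V →ₗ[ℂ] SmoothSections J G W) :
    commutator ι f (B + C) = commutator ι f B + commutator ι f C := by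
  simp only [commutator, LinearMap.add_comp, LinearMap.comp_add]
  abel

theorem commutator_smul (f : C^∞⟮I, M; 𝓘(ℝ, ℝ), ℝ⟯) (c : ℂ)
    (B : SmoothSections I F V →ₗ[ℂ] SmoothSections J G W) :
    commutator ι f (c • B) = c • commutator ι f B := by
  simp only [commutator, LinearMap.smul_comp, LinearMap.comp_smul]
  module

theorem commutator_zero (f : C^∞⟮I, M; 𝓘(ℝ, ℝ), ℝ⟯) :
    commutator ι f (0 : SmoothSections I F V →ₗ[ℂ] SmoothSections J G W) = 0 := by
  simpa only [zero_smul] using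
    commutator_smul (ι := ι) f 0 (0 : SmoothSections I F V →ₗ[ℂ] SmoothSections J G W)

theorem isDiffOp_zero (m : ℕ) :
    IsDiffOp ι m (0 : SmoothSections I F V →ₗ[ℂ] SmoothSections J G W) := by
  induction m with
  | zero => exact commutator_zero
  | succ m ih => intro f; rwa [commutator_zero]

theorem IsDiffOp.add {m : ℕ} (hB : IsDiffOp ι m B) (hC : IsDiffOp ι m C) :
    IsDiffOp ι m (B + C) := by
  induction m generalizing B C with
  | zero => intro f; rw [commutator_add, hB f, hC f, add_zero]
  | succ m ih => intro f; rw [commutator_add]; exact ih (hB f) (hC f)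

theorem IsDiffOp.smul {m : ℕ} (c : ℂ) (hB : IsDiffOp ι m B) : IsDiffOp ι m (c • B) := by
  induction m generalizing B with
  | zero => intro f; rw [commutator_smul, hB f, smul_zero]
  | succ m ih => intro f; rw [commutator_smul]; exact ih (hB f)

theorem IsDiffOp.succ {m : ℕ} (hB : IsDiffOp ι m B) : IsDiffOp ι (m + 1) B := by
  induction m generalizing B with
  | zero => intro f; rw [hB f]; exact isDiffOp_zero 0
  | succ m ih => intro f; exact ih (hB f)

variable (V W ι) in
/-- The differential operators of order at most `m` along `ι`, as a space of linear maps. -/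
def diffOps (m : ℕ) : Submodule ℂ (SmoothSections I F V →ₗ[ℂ] SmoothSections J G W) where
  carrier := {B | IsDiffOp ι m B}
  add_mem' := IsDiffOp.add
  zero_mem' := isDiffOp_zero m
  smul_mem' c _ hB := hB.smul c

theorem diffOps_mono : Monotone
    (diffOps V W ι : ℕ → Submodule ℂ (SmoothSections I F V →ₗ[ℂ] SmoothSections J G W)) :=
  monotone_nat_of_le_succ fun _ _ => IsDiffOp.succ

theorem notMem_diffOps_of_lt_diffOrder {m : ℕ} (h : m < diffOrder ι B) : B ∉ diffOps V W ι m :=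
  Nat.notMem_of_lt_sInf h

theorem mem_diffOps_diffOrder (hB : ∃ m, IsDiffOp ι m B) : B ∈ diffOps V W ι (diffOrder ι B) :=
  Nat.sInf_mem hB

theorem diffOrder_smul_add_smul {m : ℕ} (hB : B ∈ diffOps V W ι m) (hC : m < diffOrder ι C) (b : ℂ)
    {c : ℂ} (hc : c ≠ 0) : diffOrder ι (b • B + c • C) = diffOrder ι C := by
  have mem_iff {p : ℕ} (hp : m ≤ p) : b • B + c • C ∈ diffOps V W ι p ↔ C ∈ diffOps V W ι p :=
    (Submodule.add_mem_iff_right (M := SmoothSections I F V →ₗ[ℂ] SmoothSections J G W) _ <|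
      Submodule.smul_mem _ b (diffOps_mono hp hB)).trans <| Submodule.smul_mem_iff _ hc
  have notMem {p : ℕ} (hp : p ≤ m) : C ∉ diffOps V W ι p :=
    notMem_diffOps_of_lt_diffOrder (hp.trans_lt hC)
  refine congrArg sInf (Set.ext fun p => ?_)
  rcases le_total m p with hp | hp
  · exact mem_iff hp
  · exact iff_of_false (fun h => notMem le_rfl ((mem_iff le_rfl).1 (diffOps_mono hp h))) (notMem hp)

end DiffOp

/-! ### Boundary problems -/

section Problem

variable {E : Type*} [NormedAddCommGroup E] [InnerProductSpace ℝ E]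
  {H : Type*} [TopologicalSpace H] {I : ModelWithCorners ℝ E H}
  {M : Type*} [TopologicalSpace M] [ChartedSpace H M]
  {F : Type*} [NormedAddCommGroup F] [NormedSpace ℂ F]
  {V : M → Type*} [TopologicalSpace (TotalSpace F V)] [∀ x, TopologicalSpace (V x)]
  [∀ x, AddCommGroup (V x)] [∀ x, Module ℂ (V x)]
  [FiberBundle F V] [VectorBundle ℝ F V] [VectorBundle ℂ F V]
  {E' : Type*} [NormedAddCommGroup E'] [InnerProductSpace ℝ E']
  {H' : Type*} [TopologicalSpace H'] {J : ModelWithCorners ℝ E' H'}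
  {N : Type*} [TopologicalSpace N] [ChartedSpace H' N]
  {k : ℕ} {G : Fin k → Type*} [∀ j, NormedAddCommGroup (G j)] [∀ j, NormedSpace ℂ (G j)]
  {W : ∀ _ : Fin k, N → Type*} [∀ j, TopologicalSpace (TotalSpace (G j) (W j))]
  [∀ j x, TopologicalSpace (W j x)] [∀ j x, AddCommGroup (W j x)] [∀ j x, Module ℂ (W j x)]
  [∀ j, FiberBundle (G j) (W j)] [∀ j, VectorBundle ℝ (G j) (W j)]
  [∀ j, VectorBundle ℂ (G j) (W j)]
  {ι : C^∞⟮J, N; I, M⟯} {B B₀ B₁ C : ∀ j, SmoothSections I F V →ₗ[ℂ] SmoothSections J (G j) (W j)}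

theorem interp_eq_add_smul (B₀ B₁ : ∀ j, SmoothSections I F V →ₗ[ℂ] SmoothSections J (G j) (W j))
    (t τ : ℝ) : interp B₀ B₁ τ = interp B₀ B₁ t + ((τ : ℂ) - t) • (B₁ - B₀) := by
  funext j
  simp only [interp, Pi.add_apply, Pi.smul_apply, Pi.sub_apply, Complex.ofReal_sub,
    Complex.ofReal_one]
  module

theorem sub_mem_of_interp_mem
    {P : Submodule ℂ (∀ j, SmoothSections I F V →ₗ[ℂ] SmoothSections J (G j) (W j))} {s t : ℝ}
    (hst : s ≠ t) (hs : interp B₀ B₁ s ∈ P) (ht : interp B₀ B₁ t ∈ P) : B₁ - B₀ ∈ P := by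
  rw [interp_eq_add_smul B₀ B₁ t s] at hs
  have hne : (s : ℂ) - t ≠ 0 := sub_ne_zero.2 (mod_cast hst)
  exact (P.smul_mem_iff hne).1 ((Submodule.add_mem_iff_right
    (M := ∀ j, SmoothSections I F V →ₗ[ℂ] SmoothSections J (G j) (W j)) P ht).1 hs)

theorem orders_interp (hB₀ : ∀ j, ∃ m, IsDiffOp ι m (B₀ j))
    (hord : ∀ j, diffOrder ι (B₀ j) < diffOrder ι (B₁ j)) {t : ℝ} (ht : t ≠ 0) :
    orders ι (interp B₀ B₁ t) = orders ι B₁ :=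
  funext fun j => diffOrder_smul_add_smul (mem_diffOps_diffOrder (hB₀ j)) (hord j) _ (mod_cast ht)

variable [FiniteDimensional ℝ E] [MeasurableSpace E] [BorelSpace E] [CompactSpace M]
  [IsManifold I ∞ M] [ContMDiffVectorBundle ∞ F V I]
  [FiniteDimensional ℝ E'] [MeasurableSpace E'] [BorelSpace E'] [J.Boundaryless] [CompactSpace N]
  [IsManifold J ∞ N] [∀ j, FiniteDimensional ℂ (G j)]
  [∀ j, ContMDiffVectorBundle ∞ (G j) (W j) J]
  {𝔞 : SobolevAtlas I F V} {𝔟 : ∀ j, SobolevAtlas J (G j) (W j)} {r : ℕ} {m : Fin k → ℕ}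
  {A : SmoothSections I F V →ₗ[ℂ] SmoothSections I F V}

theorem denseRange_toSobolev (𝔞 : SobolevAtlas I F V) (r : ℕ) : DenseRange (toSobolev 𝔞 r) :=
  denseRange_codRestrict_topologicalClosure (sobolevJet 𝔞 r)

variable (𝔞 𝔟 r m) in
/-- The tuples `B` of operators for which `B_j` is bounded from `H^r(V)` to `H^{r - m_j - 1/2}(W_j)`
for all `j`, so that `boundaryExt 𝔞 𝔟 r m B` is an extension of `B`. -/
def boundedBoundaryOps :
    Submodule ℂ (∀ j, SmoothSections I F V →ₗ[ℂ] SmoothSections J (G j) (W j)) :=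
  .pi univ fun j => (boundedAlong (toSobolev 𝔞 r) _).comap
    (LinearMap.compRight ℂ (toFracSobolev (𝔟 j) ((r : ℝ) - m j - 1 / 2)))

theorem mem_boundedBoundaryOps_of_surjective_boundaryExt
    (hB : Function.Surjective (boundaryExt 𝔞 𝔟 r m B)) : B ∈ boundedBoundaryOps 𝔞 𝔟 r m :=
  fun j _ => mem_boundedAlong_of_surjective_extendOfNorm ((Function.surjective_eval j).comp hB)

theorem boundaryExt_add_smul (c : ℂ) (hB : B ∈ boundedBoundaryOps 𝔞 𝔟 r m)
    (hC : C ∈ boundedBoundaryOps 𝔞 𝔟 r m) :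
    boundaryExt 𝔞 𝔟 r m (B + c • C) = boundaryExt 𝔞 𝔟 r m B + c • boundaryExt 𝔞 𝔟 r m C := by
  ext u j
  have h := extendOfNorm_add_smul (denseRange_toSobolev 𝔞 r) c (hB j trivial) (hC j trivial)
  rw [← map_smul, ← map_add] at h
  exact congrArg (fun T => T u) h

variable [FiniteDimensional ℂ F]

theorem bijective_problem_of_notMem_realizationSpectrum
    (hB : Function.Surjective (boundaryExt 𝔞 𝔟 r (orders ι B) B)) {z : ℂ}
    (hz : z ∉ realizationSpectrum 𝔞 𝔟 ι r A B) :
    Function.Bijective (problem 𝔞 𝔟 ι r A B z) :=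
  bijective_prod_of_bijective_domRestrict_ker
    (L := (interiorExt 𝔞 r A - z • inclL2 𝔞 r).toLinearMap) hB (not_not.1 hz)

theorem surjective_boundaryExt_of_surjective_problem {z : ℂ}
    (h : Function.Surjective (problem 𝔞 𝔟 ι r A B z)) :
    Function.Surjective (boundaryExt 𝔞 𝔟 r (orders ι B) B) :=
  Prod.snd_surjective.comp h

theorem hasDerivAt_poissonOp {z : ℂ} (hz : Function.Bijective (problem 𝔞 𝔟 ι r A B z)) :
    HasDerivAt (fun ζ : ℂ => poissonOp 𝔞 𝔟 ι r A B ζ)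
      (resolventOp 𝔞 𝔟 ι r A B z ∘L inclL2 𝔞 r ∘L poissonOp 𝔞 𝔟 ι r A B z) z := by
  have hL : HasDerivAt (fun ζ : ℂ => interiorExt 𝔞 r A - ζ • inclL2 𝔞 r) (-inclL2 𝔞 r) z := by
    simpa using ((hasDerivAt_id z).smul_const (inclL2 𝔞 r)).const_sub (interiorExt 𝔞 r A)
  refine (hasDerivAt_inverse_prod_comp_inr hL hz).congr_deriv ?_
  simp only [ContinuousLinearMap.neg_comp, ContinuousLinearMap.comp_neg, neg_neg]
  rfl

theorem resolventOp_eq_of_orders_eq (hm : orders ι B = m) (z : ℂ) :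
    resolventOp 𝔞 𝔟 ι r A B z =
      ((interiorExt 𝔞 r A - z • inclL2 𝔞 r).prod (boundaryExt 𝔞 𝔟 r m B)).inverse ∘L
        .inl ℂ (SobolevSpace 𝔞 0) (BoundaryData 𝔟 r m) := by
  subst hm
  rfl

theorem hasDerivAt_resolventOp_interp {t : ℝ} {z : ℂ}
    (hord : ∀ᶠ τ in 𝓝 t, orders ι (interp B₀ B₁ τ) = orders ι (interp B₀ B₁ t))
    (ht : interp B₀ B₁ t ∈ boundedBoundaryOps 𝔞 𝔟 r (orders ι (interp B₀ B₁ t)))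
    (hB : B₁ - B₀ ∈ boundedBoundaryOps 𝔞 𝔟 r (orders ι (interp B₀ B₁ t)))
    (hz : Function.Bijective (problem 𝔞 𝔟 ι r A (interp B₀ B₁ t) z)) :
    HasDerivAt (fun τ : ℝ => resolventOp 𝔞 𝔟 ι r A (interp B₀ B₁ τ) z)
      (-(poissonOp 𝔞 𝔟 ι r A (interp B₀ B₁ t) z ∘L
        boundaryExt 𝔞 𝔟 r (orders ι (interp B₀ B₁ t)) (B₁ - B₀) ∘L
          resolventOp 𝔞 𝔟 ι r A (interp B₀ B₁ t) z)) t := by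
  set m := orders ι (interp B₀ B₁ t)
  let T (ζ : ℂ) := boundaryExt 𝔞 𝔟 r m (interp B₀ B₁ t) + (ζ - t) • boundaryExt 𝔞 𝔟 r m (B₁ - B₀)
  have hT (τ : ℝ) : boundaryExt 𝔞 𝔟 r m (interp B₀ B₁ τ) = T τ := by
    rw [interp_eq_add_smul B₀ B₁ t τ, boundaryExt_add_smul _ ht hB]
  have hT' : HasDerivAt T (boundaryExt 𝔞 𝔟 r m (B₁ - B₀)) t := by
    simpa [T] using (((hasDerivAt_id (t : ℂ)).sub_const (t : ℂ)).smul_const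
      (boundaryExt 𝔞 𝔟 r m (B₁ - B₀))).const_add (boundaryExt 𝔞 𝔟 r m (interp B₀ B₁ t))
  have hbij : Function.Bijective ((interiorExt 𝔞 r A - z • inclL2 𝔞 r).prod (T t)) := by
    rwa [← hT]
  have hR := (hasDerivAt_inverse_prod_comp_inl hT' hbij).scomp t Complex.ofRealCLM.hasDerivAt
  refine (hR.congr_of_eventuallyEq ?_).congr_deriv ?_
  · filter_upwards [hord] with τ hτ
    rw [resolventOp_eq_of_orders_eq hτ, hT]
    rfl
  · rw [← hT]
    exact one_smul ℝ _

end Problem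

end BVP

theorem mainTheorem5_general
    {E : Type*} [NormedAddCommGroup E] [InnerProductSpace ℝ E] [FiniteDimensional ℝ E]
    [MeasurableSpace E] [BorelSpace E]
    {H : Type*} [TopologicalSpace H] {I : ModelWithCorners ℝ E H}
    {M : Type*} [TopologicalSpace M] [ChartedSpace H M] [CompactSpace M] [IsManifold I ∞ M]
    {E' : Type*} [NormedAddCommGroup E'] [InnerProductSpace ℝ E'] [FiniteDimensional ℝ E']
    [MeasurableSpace E'] [BorelSpace E']
    {H' : Type*} [TopologicalSpace H'] {J : ModelWithCorners ℝ E' H'} [J.Boundaryless]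
    {N : Type*} [TopologicalSpace N] [ChartedSpace H' N] [CompactSpace N] [IsManifold J ∞ N]
    (ι : C^∞⟮J, N; I, M⟯)
    {F : Type*} [NormedAddCommGroup F] [NormedSpace ℂ F] [FiniteDimensional ℂ F]
    {V : M → Type*} [TopologicalSpace (TotalSpace F V)] [∀ x, TopologicalSpace (V x)]
    [∀ x, AddCommGroup (V x)] [∀ x, Module ℂ (V x)] [FiberBundle F V] [VectorBundle ℝ F V]
    [VectorBundle ℂ F V] [ContMDiffVectorBundle ∞ F V I]
    {k : ℕ} {G : Fin k → Type*} [∀ j, NormedAddCommGroup (G j)] [∀ j, NormedSpace ℂ (G j)]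
    [∀ j, FiniteDimensional ℂ (G j)]
    {W : ∀ _ : Fin k, N → Type*} [∀ j, TopologicalSpace (TotalSpace (G j) (W j))]
    [∀ j x, TopologicalSpace (W j x)] [∀ j x, AddCommGroup (W j x)] [∀ j x, Module ℂ (W j x)]
    [∀ j, FiberBundle (G j) (W j)] [∀ j, VectorBundle ℝ (G j) (W j)]
    [∀ j, VectorBundle ℂ (G j) (W j)] [∀ j, ContMDiffVectorBundle ∞ (G j) (W j) J]
    (𝔞 : BVP.SobolevAtlas I F V) (𝔟 : ∀ j, BVP.SobolevAtlas J (G j) (W j)) (r : ℕ)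
    (A : BVP.SmoothSections I F V →ₗ[ℂ] BVP.SmoothSections I F V)
    {B₀ B₁ : ∀ j, BVP.SmoothSections I F V →ₗ[ℂ] BVP.SmoothSections J (G j) (W j)}
    (hB₀ : ∀ j, ∃ m, BVP.IsDiffOp ι m (B₀ j))
    (hord : ∀ j, BVP.diffOrder ι (B₀ j) < BVP.diffOrder ι (B₁ j))
    {T : Set ℝ} (hT : (T \ {0}).Nontrivial)
    (hsurj : ∀ t ∈ T, Function.Surjective (BVP.problem 𝔞 𝔟 ι r A (BVP.interp B₀ B₁ t) 0)) :
    (∀ t ∈ T, ∀ z ∉ BVP.realizationSpectrum 𝔞 𝔟 ι r A (BVP.interp B₀ B₁ t),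
      Function.Bijective (BVP.problem 𝔞 𝔟 ι r A (BVP.interp B₀ B₁ t) z)) ∧
    (∀ t ∈ T \ {0}, ∀ z ∉ BVP.realizationSpectrum 𝔞 𝔟 ι r A (BVP.interp B₀ B₁ t),
      HasDerivAt (fun τ : ℝ => BVP.resolventOp 𝔞 𝔟 ι r A (BVP.interp B₀ B₁ τ) z)
        (-(BVP.poissonOp 𝔞 𝔟 ι r A (BVP.interp B₀ B₁ t) z ∘L
          BVP.boundaryExt 𝔞 𝔟 r (BVP.orders ι (BVP.interp B₀ B₁ t)) (B₁ - B₀) ∘L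
            BVP.resolventOp 𝔞 𝔟 ι r A (BVP.interp B₀ B₁ t) z)) t) ∧
    (∀ t ∈ T, ∀ z ∉ BVP.realizationSpectrum 𝔞 𝔟 ι r A (BVP.interp B₀ B₁ t),
      HasDerivAt (fun ζ : ℂ => BVP.poissonOp 𝔞 𝔟 ι r A (BVP.interp B₀ B₁ t) ζ)
        (BVP.resolventOp 𝔞 𝔟 ι r A (BVP.interp B₀ B₁ t) z ∘L BVP.inclL2 𝔞 r ∘L
          BVP.poissonOp 𝔞 𝔟 ι r A (BVP.interp B₀ B₁ t) z) z) := by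
  have hbdry (t : ℝ) (ht : t ∈ T) := BVP.surjective_boundaryExt_of_surjective_problem (hsurj t ht)
  have hbij (t : ℝ) (ht : t ∈ T) (z : ℂ)
      (hz : z ∉ BVP.realizationSpectrum 𝔞 𝔟 ι r A (BVP.interp B₀ B₁ t)) :
      Function.Bijective (BVP.problem 𝔞 𝔟 ι r A (BVP.interp B₀ B₁ t) z) :=
    BVP.bijective_problem_of_notMem_realizationSpectrum (hbdry t ht) hz
  refine ⟨hbij, fun t ht z hz => ?_, fun t ht z hz => BVP.hasDerivAt_poissonOp (hbij t ht z hz)⟩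
  have hord_eq {τ : ℝ} (hτ : τ ≠ 0) :
      BVP.orders ι (BVP.interp B₀ B₁ τ) = BVP.orders ι (BVP.interp B₀ B₁ t) :=
    (BVP.orders_interp hB₀ hord hτ).trans (BVP.orders_interp hB₀ hord ht.2).symm
  have hbdd {s : ℝ} (hs : s ∈ T \ {0}) : BVP.interp B₀ B₁ s ∈
      BVP.boundedBoundaryOps 𝔞 𝔟 r (BVP.orders ι (BVP.interp B₀ B₁ t)) :=
    hord_eq hs.2 ▸ BVP.mem_boundedBoundaryOps_of_surjective_boundaryExt (hbdry s hs.1)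
  obtain ⟨s, hs, hst⟩ := hT.exists_ne t
  exact BVP.hasDerivAt_resolventOp_interp
    ((eventually_ne_nhds ht.2).mono fun _ => hord_eq) (hbdd ht)
    (BVP.sub_mem_of_interp_mem hst (hbdd hs) (hbdd ht)) (hbij t ht.1 z hz)

theorem mainTheorem5
    {n : ℕ} (hn : 1 ≤ n)
    {M : Type*} [TopologicalSpace M] [ChartedSpace (EuclideanHalfSpace (n + 1)) M]
    [CompactSpace M] [T2Space M] [IsManifold (𝓡∂ (n + 1)) ∞ M]
    {N : Type*} [TopologicalSpace N] [ChartedSpace (EuclideanSpace ℝ (Fin n)) N]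
    [CompactSpace N] [T2Space N] [Nonempty N] [IsManifold (𝓡 n) ∞ N]
    (ι : C^∞⟮𝓡 n, N; 𝓡∂ (n + 1), M⟯)
    (hι : IsSmoothEmbedding (𝓡 n) (𝓡∂ (n + 1)) ∞ ι)
    (hrange : range ι = (𝓡∂ (n + 1)).boundary M)
    {F : Type*} [NormedAddCommGroup F] [NormedSpace ℂ F] [FiniteDimensional ℂ F]
    {V : M → Type*} [TopologicalSpace (TotalSpace F V)] [∀ x, TopologicalSpace (V x)]
    [∀ x, AddCommGroup (V x)] [∀ x, Module ℂ (V x)] [FiberBundle F V] [VectorBundle ℝ F V]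
    [VectorBundle ℂ F V] [ContMDiffVectorBundle ∞ F V (𝓡∂ (n + 1))]
    {k : ℕ} {G : Fin k → Type*} [∀ j, NormedAddCommGroup (G j)] [∀ j, NormedSpace ℂ (G j)]
    [∀ j, FiniteDimensional ℂ (G j)]
    {W : ∀ _ : Fin k, N → Type*} [∀ j, TopologicalSpace (TotalSpace (G j) (W j))]
    [∀ j x, TopologicalSpace (W j x)] [∀ j x, AddCommGroup (W j x)] [∀ j x, Module ℂ (W j x)]
    [∀ j, FiberBundle (G j) (W j)] [∀ j, VectorBundle ℝ (G j) (W j)]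
    [∀ j, VectorBundle ℂ (G j) (W j)] [∀ j, ContMDiffVectorBundle ∞ (G j) (W j) (𝓡 n)]
    (𝔞 : BVP.SobolevAtlas (𝓡∂ (n + 1)) F V) (𝔟 : ∀ j, BVP.SobolevAtlas (𝓡 n) (G j) (W j))
    {r : ℕ} (hr : 0 < r)
    (A : BVP.SmoothSections (𝓡∂ (n + 1)) F V →ₗ[ℂ] BVP.SmoothSections (𝓡∂ (n + 1)) F V)
    (hA : BVP.IsDiffOp ContMDiffMap.id r A)
    (B₀ B₁ : ∀ j, BVP.SmoothSections (𝓡∂ (n + 1)) F V →ₗ[ℂ] BVP.SmoothSections (𝓡 n) (G j) (W j))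
    (hB₀ : ∀ j, ∃ m, BVP.IsDiffOp ι m (B₀ j)) (hB₁ : ∀ j, ∃ m, BVP.IsDiffOp ι m (B₁ j))
    (hord : ∀ j, BVP.diffOrder ι (B₀ j) < BVP.diffOrder ι (B₁ j))
    (hordr : ∀ j, BVP.diffOrder ι (B₁ j) < r)
    (hinv : ∀ t ∈ Icc (0 : ℝ) 1,
      Function.Bijective (BVP.problem 𝔞 𝔟 ι r A (BVP.interp B₀ B₁ t) 0)) :
    (∀ t ∈ Icc (0 : ℝ) 1, ∀ z ∉ BVP.realizationSpectrum 𝔞 𝔟 ι r A (BVP.interp B₀ B₁ t),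
      Function.Bijective (BVP.problem 𝔞 𝔟 ι r A (BVP.interp B₀ B₁ t) z)) ∧
    (∀ t ∈ Ioc (0 : ℝ) 1, ∀ z ∉ BVP.realizationSpectrum 𝔞 𝔟 ι r A (BVP.interp B₀ B₁ t),
      HasDerivAt (fun τ : ℝ => BVP.resolventOp 𝔞 𝔟 ι r A (BVP.interp B₀ B₁ τ) z)
        (-(BVP.poissonOp 𝔞 𝔟 ι r A (BVP.interp B₀ B₁ t) z ∘L
          BVP.boundaryExt 𝔞 𝔟 r (BVP.orders ι (BVP.interp B₀ B₁ t)) (B₁ - B₀) ∘L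
            BVP.resolventOp 𝔞 𝔟 ι r A (BVP.interp B₀ B₁ t) z)) t) ∧
    (∀ t ∈ Icc (0 : ℝ) 1, ∀ z ∉ BVP.realizationSpectrum 𝔞 𝔟 ι r A (BVP.interp B₀ B₁ t),
      HasDerivAt (fun ζ : ℂ => BVP.poissonOp 𝔞 𝔟 ι r A (BVP.interp B₀ B₁ t) ζ)
        (BVP.resolventOp 𝔞 𝔟 ι r A (BVP.interp B₀ B₁ t) z ∘L BVP.inclL2 𝔞 r ∘L
          BVP.poissonOp 𝔞 𝔟 ι r A (BVP.interp B₀ B₁ t) z) z) := by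
  have hT : (Icc (0 : ℝ) 1 \ {0}).Nontrivial := by
    rw [Icc_sdiff_left]
    exact (Ioc_infinite one_pos).nontrivial
  simpa only [Icc_sdiff_left] using
    mainTheorem5_general ι 𝔞 𝔟 r A hB₀ hord hT fun t ht => (hinv t ht).surjective
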